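/- Let $n\ge 1$, and let $U$ and $U_1,\dots,U_K$ be bounded open subsets of $\mathbb{R}^n$ such that the $U_j$ are pairwise disjoint and $\overline{U}=\bigcup_{j=1}^{K}\overline{U}_j$. Assume that the boundary of each piece has finite surface measure, that is, $\mathcal{H}^{n-1}(\partial U_j)<\infty$ for every $j$, where $\mathcal{H}^{n-1}$ is the $(n-1)$-dimensional Hausdorff measure (this holds, for instance, if every $U_j$ has a Lipschitz boundary). Let $u:\overline{U}\to\mathbb{R}$ be continuous and suppose that $u\in H^1(U_j)$ for every $j$. Then $u\in H^1(U)$. Here, for an open set $V\subseteq\mathbb{R}^n$, $H^1(V)$ is the space of all $u\in L^2(V)$ that have weak partial derivatives $\partial_i u\in L^2(V)$, $i=1,\dots,n$, i.e. functions with $\int_V u\,\partial_i\varphi=-\int_V(\partial_i u)\,\varphi$ for all $\varphi\in C_0^\infty(V)$. -/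

import Mathlib

open MeasureTheory
open scoped ContDiff

/-- `φ` is a test function on `V`: it is smooth, with compact support contained in `V`. -/
def IsTestFunctionOn {n : ℕ} (V : Set (EuclideanSpace ℝ (Fin n)))
    (φ : EuclideanSpace ℝ (Fin n) → ℝ) : Prop :=
  ContDiff ℝ ∞ φ ∧ HasCompactSupport φ ∧ tsupport φ ⊆ V

/-- The `i`-th classical partial derivative of `φ` at `x`. -/
noncomputable def partialDeriv {n : ℕ} (i : Fin n) (φ : EuclideanSpace ℝ (Fin n) → ℝ)
    (x : EuclideanSpace ℝ (Fin n)) : ℝ :=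
  fderiv ℝ φ x (EuclideanSpace.single i 1)

/-- `g` is a weak `i`-th partial derivative of `u` on `V`. It is used only for `u` and `g` that
are square integrable on `V`, so that both integrals converge. -/
def IsWeakPartialDerivOn {n : ℕ} (V : Set (EuclideanSpace ℝ (Fin n))) (i : Fin n)
    (u g : EuclideanSpace ℝ (Fin n) → ℝ) : Prop :=
  ∀ φ : EuclideanSpace ℝ (Fin n) → ℝ, IsTestFunctionOn V φ →
    ∫ x in V, u x * partialDeriv i φ x = -∫ x in V, g x * φ x

/-- (The restriction to `V` of) `u` belongs to the Sobolev space `H¹(V)`: `u` is in `L²(V)` and has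
all first-order weak partial derivatives in `L²(V)`. -/
def MemH1 {n : ℕ} (V : Set (EuclideanSpace ℝ (Fin n)))
    (u : EuclideanSpace ℝ (Fin n) → ℝ) : Prop :=
  MemLp u 2 (volume.restrict V) ∧
    ∀ i : Fin n, ∃ g : EuclideanSpace ℝ (Fin n) → ℝ,
      MemLp g 2 (volume.restrict V) ∧ IsWeakPartialDerivOn V i u g

open Metric Filter Topology Set

/-! Let `F` be the union of the frontiers of the pieces and `g` the function glued from their weak
derivatives. Every point of `U \ F` lies in some piece, so `g` is a weak derivative of `u` off `F`;
it remains to cross `F`, which needs neither traces nor normals.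

For a test function `φ` on `U`, take cutoffs `η m` equal to 1 near `F`, with supports shrinking to
`F`. Testing with `φ (1 - η m)` gives `∫ u ∂φ (1 - η m) - ∫ u φ ∂(η m) = -∫ g φ (1 - η m)`. As `F`
is Lebesgue null, dominated convergence handles the first and last integrals.

The middle one must vanish in the limit. Finite `(n - 1)`-dimensional measure gives covers of `F` by
balls with `∑ r ^ (n - 1)` bounded, and a bump on a ball of radius `r` has derivative of `L¹` norm
of order `r ^ (n - 1)`; so `∂(η m)` is bounded in `L¹` (`exists_cutoff_of_hausdorffMeasure_lt_top`).
Since `u φ` is uniformly continuous, it can be replaced by a smooth function, onto which the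
derivative is moved by parts (`tendsto_integral_mul_partialDeriv_zero`). -/

/-! ### Coverings and cutoffs for sets of finite Hausdorff measure -/

/-- A compact set of finite `d`-dimensional Hausdorff measure is covered by finitely many balls of
arbitrarily small radii, with the sum of the `d`-th powers of the radii bounded. -/
theorem exists_finset_ball_cover_of_hausdorffMeasure_lt_top {X : Type*} [MetricSpace X]
    [MeasurableSpace X] [BorelSpace X] [Nonempty X] {F : Set X} (hF : IsCompact F) {d : ℝ} (hd : 0 ≤ d)
    (h : Measure.hausdorffMeasure d F < ⊤) :
    ∃ C : ℝ, ∀ δ > 0, ∃ (s : Finset ℕ) (x : ℕ → X) (r : ℕ → ℝ),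
      (∀ k ∈ s, x k ∈ F ∧ 0 < r k ∧ r k < δ) ∧ F ⊆ ⋃ k ∈ s, ball (x k) (r k) ∧
      ∑ k ∈ s, r k ^ d ≤ C := by
  -- One unit pays for a nearly optimal cover, the other for enlarging diameters to radii.
  refine ⟨(Measure.hausdorffMeasure d F + 1 + 1).toReal, fun δ hδ => ?_⟩
  have hδ2 : (0 : ENNReal) < ENNReal.ofReal (δ / 2) := by simpa using hδ
  have h1 := ENNReal.lt_add_right h.ne one_ne_zero
  conv_lhs at h1 => rw [Measure.hausdorffMeasure_apply]
  have h2 := (le_iSup₂ (f := fun (r : ENNReal) (_ : 0 < r) =>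
    ⨅ (t : ℕ → Set X) (_ : F ⊆ ⋃ n, t n) (_ : ∀ n, ediam (t n) ≤ r),
      ∑' n, ⨆ _ : (t n).Nonempty, ediam (t n) ^ d) _ hδ2).trans_lt h1
  simp only [iInf_lt_iff] at h2
  obtain ⟨t, htF, htd, hts⟩ := h2
  obtain ⟨ε, hε, hεs⟩ := ENNReal.exists_pos_sum_of_countable (ε := 1) one_ne_zero ℕ
  have hfin : ∀ k, ediam (t k) ≠ ⊤ := fun k => ((htd k).trans_lt ENNReal.ofReal_lt_top).ne
  -- An open ball about a point of `t k` contains `t k` once its radius exceeds the diameter, which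
  -- may be 0; continuity of `ρ ^ d` makes the excess cost at most `ε k`.
  have hrad : ∀ k, ∃ ρ : ℝ, diam (t k) < ρ ∧ ρ < δ ∧ ρ ^ d < diam (t k) ^ d + ε k := by
    intro k
    have hk : diam (t k) < δ := by
      have : diam (t k) ≤ δ / 2 := ENNReal.toReal_le_of_le_ofReal (by positivity) (htd k)
      linarith
    have hc : ContinuousAt (fun ρ : ℝ => ρ ^ d) (diam (t k)) :=
      Real.continuousAt_rpow_const _ _ (Or.inr hd)
    have e1 : ∀ᶠ ρ in 𝓝[>] diam (t k), ρ < δ := (eventually_lt_nhds hk).filter_mono inf_le_left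
    have e2 : ∀ᶠ ρ in 𝓝[>] diam (t k), ρ ^ d < diam (t k) ^ d + ε k :=
      (hc.eventually_lt continuousAt_const (by simpa using hε k)).filter_mono inf_le_left
    have e3 : ∀ᶠ ρ in 𝓝[>] diam (t k), diam (t k) < ρ := self_mem_nhdsWithin
    obtain ⟨ρ, h1, h2, h3⟩ := (e1.and (e2.and e3)).exists
    exact ⟨ρ, h3, h1, h2⟩
  choose ρ hρ1 hρ2 hρ3 using hrad
  have hcen : ∀ k, ∃ x, (t k ∩ F).Nonempty → x ∈ t k ∩ F := by
    intro k
    by_cases hk : (t k ∩ F).Nonempty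
    · exact ⟨hk.some, fun _ => hk.some_mem⟩
    · exact ⟨Classical.arbitrary X, fun h => absurd h hk⟩
  choose x hx using hcen
  obtain ⟨b, hbS, hbf, hbF⟩ := hF.elim_finite_subcover_image
    (b := {k | (t k ∩ F).Nonempty}) (c := fun k => ball (x k) (ρ k)) (fun _ _ => isOpen_ball) (by
      intro y hy
      obtain ⟨k, hk⟩ := mem_iUnion.1 (htF hy)
      refine mem_iUnion₂.2 ⟨k, ⟨y, hk, hy⟩, ?_⟩
      exact (dist_le_diam_of_mem' (hfin k) hk (hx k ⟨y, hk, hy⟩).1).trans_lt (hρ1 k))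
  lift b to Finset ℕ using hbf
  have hρ0 : ∀ k, 0 < ρ k := fun k => diam_nonneg.trans_lt (hρ1 k)
  refine ⟨b, x, ρ, fun k hk => ⟨(hx k (hbS hk)).2, hρ0 k, hρ2 k⟩, hbF, ?_⟩
  rw [← ENNReal.ofReal_le_iff_le_toReal (by finiteness),
    ENNReal.ofReal_sum_of_nonneg fun k _ => Real.rpow_nonneg (hρ0 k).le _]
  have hterm : ∀ k ∈ b, ENNReal.ofReal (ρ k ^ d) ≤
      (⨆ _ : (t k).Nonempty, ediam (t k) ^ d) + ε k := by
    intro k hk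
    -- Nonemptiness matters when `d = 0`, where an empty set would otherwise count as `0 ^ 0 = 1`.
    rw [ciSup_pos ((hbS hk).mono inter_subset_left)]
    refine (ENNReal.ofReal_le_ofReal (hρ3 k).le).trans ?_
    rw [ENNReal.ofReal_add (Real.rpow_nonneg (diam_nonneg (s := t k)) _) (ε k).coe_nonneg, ENNReal.ofReal_coe_nnreal,
      ← ENNReal.ofReal_rpow_of_nonneg (diam_nonneg (s := t k)) hd, diam, ENNReal.ofReal_toReal (hfin k)]
  refine (Finset.sum_le_sum hterm).trans ?_
  rw [Finset.sum_add_distrib]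
  exact add_le_add ((ENNReal.sum_le_tsum b).trans hts.le) ((ENNReal.sum_le_tsum b).trans hεs.le)

/-- A ball of radius `r` has a smooth cutoff supported in the concentric ball of radius `2 r` whose
partial derivative has an `L¹` norm of order `r ^ (n - 1)`. -/
theorem exists_ball_cutoff (n : ℕ) (i : Fin n) : ∃ C : ℝ, 0 ≤ C ∧
    ∀ (x : EuclideanSpace ℝ (Fin n)) (r : ℝ), 0 < r → ∃ η : EuclideanSpace ℝ (Fin n) → ℝ,
      ContDiff ℝ ∞ η ∧ (∀ y, 0 ≤ η y ∧ η y ≤ 1) ∧ (∀ y ∈ ball x r, η y = 1) ∧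
      (∀ y ∉ ball x (2 * r), η y = 0) ∧
      ∫ y, |partialDeriv i η y| ≤ C * r ^ ((n : ℝ) - 1) := by
  let b : ContDiffBump (0 : EuclideanSpace ℝ (Fin n)) := ⟨1, 2, one_pos, one_lt_two⟩
  -- Rescaling the unit bump gives a factor `r⁻¹` from the chain rule and `r ^ n` from the change of
  -- variables.
  refine ⟨∫ y, |partialDeriv i b y|, integral_nonneg fun _ => abs_nonneg _, fun x r hr => ?_⟩
  have hdist : ∀ y, dist (r⁻¹ • (y - x)) 0 = r⁻¹ * dist y x := fun y => by
    rw [dist_zero_right, norm_smul, Real.norm_of_nonneg (inv_nonneg.2 hr.le), dist_eq_norm]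
  refine ⟨fun y => b (r⁻¹ • (y - x)), ?_, fun y => ⟨b.nonneg, b.le_one⟩, ?_, ?_, ?_⟩
  · exact b.contDiff.comp (by fun_prop)
  · intro y hy
    apply b.one_of_mem_closedBall
    rw [mem_closedBall, hdist, inv_mul_le_iff₀ hr]
    simpa [b] using (mem_ball.1 hy).le
  · intro y hy
    apply b.zero_of_le_dist
    rw [hdist, le_inv_mul_iff₀ hr]
    simpa [b, mul_comm] using hy
  · have hd : ∀ y, partialDeriv i (fun y => b (r⁻¹ • (y - x))) y =
        r⁻¹ * partialDeriv i b (r⁻¹ • (y - x)) := by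
      intro y
      unfold partialDeriv
      rw [fderiv_comp_sub (f := fun z => b (r⁻¹ • z)), fderiv_comp_smul]
      simp
    simp_rw [hd, abs_mul, abs_of_pos (inv_pos.2 hr)]
    rw [integral_const_mul, integral_sub_right_eq_self (fun y => |partialDeriv i b (r⁻¹ • y)|) x,
      Measure.integral_comp_inv_smul_of_nonneg _ (fun y => |partialDeriv i b y|) hr.le,
      Real.rpow_sub_one hr.ne', Real.rpow_natCast]
    simp only [finrank_euclideanSpace, Fintype.card_fin, smul_eq_mul]
    apply le_of_eq
    field_simp

theorem partialDeriv_mul {n : ℕ} (i : Fin n) {f g : EuclideanSpace ℝ (Fin n) → ℝ}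
    (hf : Differentiable ℝ f) (hg : Differentiable ℝ g) (x : EuclideanSpace ℝ (Fin n)) :
    partialDeriv i (fun y => f y * g y) x = f x * partialDeriv i g x + g x * partialDeriv i f x := by
  simp [partialDeriv, fderiv_fun_mul (hf x) (hg x)]

theorem partialDeriv_one_sub {n : ℕ} (i : Fin n) (f : EuclideanSpace ℝ (Fin n) → ℝ)
    (x : EuclideanSpace ℝ (Fin n)) :
    partialDeriv i (fun y => 1 - f y) x = -partialDeriv i f x := by
  simp [partialDeriv, fderiv_const_sub]

theorem continuous_partialDeriv {n : ℕ} (i : Fin n) {f : EuclideanSpace ℝ (Fin n) → ℝ}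
    (hf : ContDiff ℝ ∞ f) : Continuous (partialDeriv i f) :=
  (hf.continuous_fderiv (by simp)).clm_apply continuous_const

theorem tsupport_partialDeriv_subset {n : ℕ} (i : Fin n) (f : EuclideanSpace ℝ (Fin n) → ℝ) :
    tsupport (partialDeriv i f) ⊆ tsupport f :=
  tsupport_fderiv_apply_subset ℝ _

/-- In the product rule every undifferentiated factor lies in `[0, 1]`, so overlaps of the supports
cost nothing. -/
theorem abs_partialDeriv_prod_one_sub_le {n : ℕ} {ι : Type*} (i : Fin n) (s : Finset ι)
    {η : ι → EuclideanSpace ℝ (Fin n) → ℝ} (hη : ∀ k ∈ s, ContDiff ℝ ∞ (η k))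
    (h01 : ∀ k ∈ s, ∀ y, 0 ≤ η k y ∧ η k y ≤ 1) (x : EuclideanSpace ℝ (Fin n)) :
    |partialDeriv i (fun y => ∏ k ∈ s, (1 - η k y)) x| ≤ ∑ k ∈ s, |partialDeriv i (η k) x| := by
  classical
  induction s using Finset.induction_on with
  | empty => simp [partialDeriv]
  | insert a s ha ih =>
    simp only [Finset.mem_insert, forall_eq_or_imp] at hη h01
    have hs : ContDiff ℝ ∞ fun y => ∏ k ∈ s, (1 - η k y) :=
      contDiff_prod fun k hk => contDiff_const.sub (hη.2 k hk)
    simp only [Finset.prod_insert ha, Finset.sum_insert ha]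
    rw [partialDeriv_mul i ((contDiff_const.sub hη.1).differentiable (by simp))
      (hs.differentiable (by simp)), partialDeriv_one_sub]
    have hP0 : 0 ≤ ∏ k ∈ s, (1 - η k x) :=
      Finset.prod_nonneg fun k hk => sub_nonneg.2 (h01.2 k hk x).2
    have hP1 : ∏ k ∈ s, (1 - η k x) ≤ 1 :=
      Finset.prod_le_one (fun k hk => sub_nonneg.2 (h01.2 k hk x).2)
        fun k hk => sub_le_self _ (h01.2 k hk x).1
    have h1 : |(1 - η a x) * partialDeriv i (fun y => ∏ k ∈ s, (1 - η k y)) x| ≤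
        ∑ k ∈ s, |partialDeriv i (η k) x| := by
      rw [abs_mul, abs_of_nonneg (sub_nonneg.2 (h01.1 x).2)]
      exact (mul_le_of_le_one_left (abs_nonneg _) (sub_le_self _ (h01.1 x).1)).trans
        (ih hη.2 h01.2)
    have h2 : |(∏ k ∈ s, (1 - η k x)) * -partialDeriv i (η a) x| ≤ |partialDeriv i (η a) x| := by
      rw [abs_mul, abs_of_nonneg hP0, abs_neg]
      exact mul_le_of_le_one_left (abs_nonneg _) hP1
    rw [add_comm |partialDeriv i (η a) x|]
    exact (abs_add_le _ _).trans (add_le_add h1 h2)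

/-- A compact set of finite `(n - 1)`-dimensional Hausdorff measure has smooth cutoffs supported in
arbitrarily small neighbourhoods whose partial derivatives are bounded in `L¹`. -/
theorem exists_cutoff_of_hausdorffMeasure_lt_top {n : ℕ} (hn : 1 ≤ n) (i : Fin n)
    {F : Set (EuclideanSpace ℝ (Fin n))} (hF : IsCompact F)
    (h : Measure.hausdorffMeasure ((n : ℝ) - 1) F < ⊤) :
    ∃ C : ℝ, ∀ δ > 0, ∃ η : EuclideanSpace ℝ (Fin n) → ℝ,
      ContDiff ℝ ∞ η ∧ HasCompactSupport η ∧ (∀ y, 0 ≤ η y ∧ η y ≤ 1) ∧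
      (∀ᶠ y in 𝓝ˢ F, η y = 1) ∧ (∀ y ∉ thickening δ F, η y = 0) ∧
      ∫ y, |partialDeriv i η y| ≤ C := by
  have hd : (0 : ℝ) ≤ (n : ℝ) - 1 := sub_nonneg.2 (by exact_mod_cast hn)
  obtain ⟨A, hA⟩ := exists_finset_ball_cover_of_hausdorffMeasure_lt_top hF hd h
  obtain ⟨B, hB0, hB⟩ := exists_ball_cutoff n i
  refine ⟨B * A, fun δ hδ => ?_⟩
  -- The bumps live on doubled balls centred in `F`, so radii below `δ / 2` keep them inside the
  -- `δ`-thickening.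
  obtain ⟨s, x, r, hs, hFs, hsum⟩ := hA (δ / 2) (half_pos hδ)
  have hη : ∀ k : ℕ, ∃ η : EuclideanSpace ℝ (Fin n) → ℝ, k ∈ s →
      ContDiff ℝ ∞ η ∧ (∀ y, 0 ≤ η y ∧ η y ≤ 1) ∧ (∀ y ∈ ball (x k) (r k), η y = 1) ∧
      (∀ y ∉ ball (x k) (2 * r k), η y = 0) ∧
      ∫ y, |partialDeriv i η y| ≤ B * r k ^ ((n : ℝ) - 1) := by
    intro k
    by_cases hk : k ∈ s
    · obtain ⟨η, h⟩ := hB (x k) (r k) (hs k hk).2.1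
      exact ⟨η, fun _ => h⟩
    · exact ⟨0, fun h => absurd h hk⟩
  choose η hη using hη
  have hsupp : ∀ k ∈ s, HasCompactSupport (η k) := fun k hk =>
    HasCompactSupport.intro (isCompact_closedBall (x k) (2 * r k)) fun y hy =>
      (hη k hk).2.2.2.1 y fun hy' => hy (ball_subset_closedBall hy')
  -- `1 - ∏ (1 - η k)` is a smooth substitute for the maximum of the bumps.
  have hZ : ContDiff ℝ ∞ fun y => 1 - ∏ k ∈ s, (1 - η k y) :=
    contDiff_const.sub (contDiff_prod fun k hk => contDiff_const.sub (hη k hk).1)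
  have hout : ∀ y ∉ thickening δ F, 1 - ∏ k ∈ s, (1 - η k y) = 0 := by
    intro y hy
    rw [Finset.prod_eq_one, sub_self]
    intro k hk
    rw [(hη k hk).2.2.2.1, sub_zero]
    intro hyk
    refine hy (mem_thickening_iff.2 ⟨x k, (hs k hk).1, hyk.trans ?_⟩)
    linarith [(hs k hk).2.2]
  refine ⟨_, hZ, ?_, fun y => ⟨?_, ?_⟩, ?_, hout, ?_⟩
  · exact HasCompactSupport.intro hF.cthickening (K := cthickening δ F) fun y hy =>
      hout y fun hy' => hy (thickening_subset_cthickening _ _ hy')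
  · exact sub_nonneg.2 (Finset.prod_le_one (fun k hk => sub_nonneg.2 ((hη k hk).2.1 y).2)
      fun k hk => sub_le_self _ ((hη k hk).2.1 y).1)
  · exact sub_le_self _ (Finset.prod_nonneg fun k hk => sub_nonneg.2 ((hη k hk).2.1 y).2)
  · have ho : IsOpen (⋃ k ∈ s, ball (x k) (r k)) := isOpen_biUnion fun _ _ => isOpen_ball
    filter_upwards [ho.mem_nhdsSet.2 hFs] with y hy
    obtain ⟨k, hk, hyk⟩ := mem_iUnion₂.1 hy
    rw [Finset.prod_eq_zero hk (by rw [(hη k hk).2.2.1 y hyk, sub_self]), sub_zero]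
  · have hint : ∀ k ∈ s, Integrable fun y => |partialDeriv i (η k) y| := fun k hk =>
      ((continuous_partialDeriv i (hη k hk).1).integrable_of_hasCompactSupport
        ((hsupp k hk).mono' (subset_closure.trans (tsupport_partialDeriv_subset i _)))).abs
    calc ∫ y, |partialDeriv i (fun y => 1 - ∏ k ∈ s, (1 - η k y)) y|
        ≤ ∫ y, ∑ k ∈ s, |partialDeriv i (η k) y| := by
          refine integral_mono_of_nonneg (ae_of_all _ fun _ => abs_nonneg _)
            (integrable_finsetSum _ hint) (ae_of_all _ fun y => ?_)
          dsimp only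
          rw [partialDeriv_one_sub i (fun y => ∏ k ∈ s, (1 - η k y)), abs_neg]
          exact abs_partialDeriv_prod_one_sub_le i s (fun k hk => (hη k hk).1)
            (fun k hk => (hη k hk).2.1) y
      _ = ∑ k ∈ s, ∫ y, |partialDeriv i (η k) y| := integral_finsetSum _ hint
      _ ≤ ∑ k ∈ s, B * r k ^ ((n : ℝ) - 1) :=
          Finset.sum_le_sum fun k hk => (hη k hk).2.2.2.2
      _ ≤ B * A := by
          rw [← Finset.mul_sum]
          exact mul_le_mul_of_nonneg_left hsum hB0

/-! ### Limits along the cutoffs -/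

/-- Finite measure in dimension `n - 1` forces measure zero in dimension `n`, and Lebesgue measure
is a multiple of `n`-dimensional Hausdorff measure. -/
theorem volume_eq_zero_of_hausdorffMeasure_lt_top {n : ℕ} {F : Set (EuclideanSpace ℝ (Fin n))}
    (h : Measure.hausdorffMeasure ((n : ℝ) - 1) F < ⊤) : volume F = 0 := by
  have h0 := (Measure.hausdorffMeasure_zero_or_top (sub_one_lt (n : ℝ)) F).resolve_right h.ne
  replace h0 : Measure.hausdorffMeasure
      (Module.finrank ℝ (EuclideanSpace ℝ (Fin n)) : ℝ) F = 0 := by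
    rwa [finrank_euclideanSpace_fin]
  have hv := Measure.isAddLeftInvariant_eq_smul (volume : Measure (EuclideanSpace ℝ (Fin n)))
    (Measure.hausdorffMeasure (Module.finrank ℝ (EuclideanSpace ℝ (Fin n))))
  rw [hv, Measure.smul_apply, h0, smul_zero]

theorem tendsto_integral_mul_of_ae_tendsto {α : Type*} [MeasurableSpace α] {μ : Measure α}
    {h : α → ℝ} (hh : Integrable h μ) {ψ : ℕ → α → ℝ} (hψm : ∀ m, AEStronglyMeasurable (ψ m) μ)
    (hψ : ∀ m x, |ψ m x| ≤ 1) {c : ℝ} (hlim : ∀ᵐ x ∂μ, Tendsto (fun m => ψ m x) atTop (𝓝 c)) :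
    Tendsto (fun m => ∫ x, h x * ψ m x ∂μ) atTop (𝓝 (∫ x, h x * c ∂μ)) := by
  refine tendsto_integral_of_dominated_convergence (fun x => |h x|)
    (fun m => hh.aestronglyMeasurable.mul (hψm m)) hh.abs (fun m => ae_of_all _ fun x => ?_)
    (hlim.mono fun x hx => hx.const_mul _)
  rw [Real.norm_eq_abs, abs_mul]
  exact mul_le_of_le_one_right (abs_nonneg _) (hψ m x)

/-- If smooth functions tend to zero almost everywhere, with uniform bounds and supports, and with
partial derivatives bounded in `L¹`, then these partial derivatives tend weakly to zero against
uniformly continuous functions. -/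
theorem tendsto_integral_mul_partialDeriv_zero {n : ℕ} (i : Fin n)
    {η : ℕ → EuclideanSpace ℝ (Fin n) → ℝ} (hη : ∀ m, ContDiff ℝ ∞ (η m))
    (hb : ∀ m x, |η m x| ≤ 1) {K : Set (EuclideanSpace ℝ (Fin n))} (hK : IsCompact K)
    (hηK : ∀ m, ∀ x ∉ K, η m x = 0) (hlim : ∀ᵐ x, Tendsto (fun m => η m x) atTop (𝓝 0)) {C : ℝ}
    (hC : ∀ m, ∫ x, |partialDeriv i (η m) x| ≤ C) {w : EuclideanSpace ℝ (Fin n) → ℝ}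
    (hw : UniformContinuous w) :
    Tendsto (fun m => ∫ x, w x * partialDeriv i (η m) x) atTop (𝓝 0) := by
  have hsupp : ∀ m, HasCompactSupport (η m) := fun m => HasCompactSupport.intro hK (hηK m)
  have hdsupp : ∀ m, HasCompactSupport (partialDeriv i (η m)) := fun m =>
    (hsupp m).mono' (subset_closure.trans (tsupport_partialDeriv_subset i _))
  have hdc : ∀ m, Continuous (partialDeriv i (η m)) := fun m => continuous_partialDeriv i (hη m)
  have hint : ∀ v : EuclideanSpace ℝ (Fin n) → ℝ, Continuous v → ∀ m,
      Integrable fun x => v x * partialDeriv i (η m) x := fun v hv m =>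
    (hv.mul (hdc m)).integrable_of_hasCompactSupport (hdsupp m).mul_left
  have hC0 : 0 ≤ C := (integral_nonneg fun _ => abs_nonneg _).trans (hC 0)
  have hsmooth : ∀ v : EuclideanSpace ℝ (Fin n) → ℝ, ContDiff ℝ ∞ v →
      Tendsto (fun m => ∫ x, v x * partialDeriv i (η m) x) atTop (𝓝 0) := by
    intro v hv
    -- The derivative of `v` need not be integrable on the whole space; on the compact `K` it is,
    -- and can dominate.
    have hparts : ∀ m, ∫ x, v x * partialDeriv i (η m) x =
        -∫ x in K, partialDeriv i v x * η m x := by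
      intro m
      rw [setIntegral_eq_integral_of_forall_compl_eq_zero fun x hx => by rw [hηK m x hx, mul_zero]]
      exact integral_mul_fderiv_eq_neg_fderiv_mul_of_integrable
        (((continuous_partialDeriv i hv).mul (hη m).continuous).integrable_of_hasCompactSupport
          (hsupp m).mul_left)
        (hint v hv.continuous m)
        ((hv.continuous.mul (hη m).continuous).integrable_of_hasCompactSupport (hsupp m).mul_left)
        (fun x _ => hv.differentiable (by simp) x) (fun x _ => (hη m).differentiable (by simp) x)
    simp_rw [hparts]
    simpa using (tendsto_integral_mul_of_ae_tendsto (μ := volume.restrict K)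
      ((continuous_partialDeriv i hv).continuousOn.integrableOn_compact hK)
      (fun m => (hη m).continuous.aestronglyMeasurable) hb (ae_restrict_of_ae hlim)).neg
  rw [Metric.tendsto_atTop]
  intro ε hε
  -- The `L¹` bound `C` turns this uniform error into at most `ε / 2`; the `+ 1` avoids division by
  -- zero when `C = 0`.
  obtain ⟨v, hv, hvw⟩ := hw.exists_contDiff_dist_le (ε := ε / (2 * (C + 1))) (by positivity)
  obtain ⟨N, hN⟩ := Metric.tendsto_atTop.1 (hsmooth v hv) (ε / 2) (half_pos hε)
  refine ⟨N, fun m hm => ?_⟩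
  have h1 := hN m hm
  rw [dist_zero_right, Real.norm_eq_abs] at h1 ⊢
  have h2 : |∫ x, (w x * partialDeriv i (η m) x - v x * partialDeriv i (η m) x)| ≤ ε / 2 := by
    calc |∫ x, (w x * partialDeriv i (η m) x - v x * partialDeriv i (η m) x)|
        ≤ ∫ x, ε / (2 * (C + 1)) * |partialDeriv i (η m) x| := by
          refine (Real.norm_eq_abs _).ge.trans (norm_integral_le_of_norm_le
            (((hdc m).integrable_of_hasCompactSupport (μ := volume) (hdsupp m)).abs.const_mul _)
            (ae_of_all _ fun x => ?_))
          rw [← sub_mul, Real.norm_eq_abs, abs_mul]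
          refine mul_le_mul_of_nonneg_right ?_ (abs_nonneg _)
          rw [abs_sub_comm]
          exact (hvw x).le
      _ ≤ ε / (2 * (C + 1)) * C := by
          rw [integral_const_mul]
          exact mul_le_mul_of_nonneg_left (hC m) (by positivity)
      _ ≤ ε / 2 := by
          rw [div_mul_eq_mul_div, div_le_div_iff₀ (by positivity) two_pos]
          nlinarith
  rw [integral_sub (hint w hw.continuous m) (hint v hv.continuous m)] at h2
  have h3 := abs_add_le ((∫ x, w x * partialDeriv i (η m) x) - ∫ x, v x * partialDeriv i (η m) x)
    (∫ x, v x * partialDeriv i (η m) x)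
  rw [sub_add_cancel] at h3
  linarith

/-! ### Gluing over disjoint open sets -/

/-- A test function on a disjoint union of open sets restricts to a test function on each of
them. -/
theorem IsTestFunctionOn.indicator_of_iUnion {n : ℕ} {ι : Type*}
    {V : ι → Set (EuclideanSpace ℝ (Fin n))} (hV : ∀ j, IsOpen (V j))
    (hdisj : Pairwise fun j k => Disjoint (V j) (V k)) {χ : EuclideanSpace ℝ (Fin n) → ℝ}
    (hχ : IsTestFunctionOn (⋃ j, V j) χ) (j : ι) :
    IsTestFunctionOn (V j) ((V j).indicator χ) := by
  have hsub : tsupport ((V j).indicator χ) ⊆ tsupport χ :=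
    closure_mono (by rw [support_indicator]; exact inter_subset_right)
  -- A point of the support lies in some `V k` and in the closure of `V j`; an open set disjoint
  -- from `V j` misses that closure, so `k = j`.
  have hVj : tsupport ((V j).indicator χ) ⊆ V j := by
    intro x hx
    obtain ⟨k, hk⟩ := mem_iUnion.1 (hχ.2.2 (hsub hx))
    have hxj : x ∈ closure (V j) :=
      closure_mono (by rw [support_indicator]; exact inter_subset_left) hx
    obtain ⟨y, hyk, hyj⟩ := mem_closure_iff.1 hxj (V k) (hV k) hk
    by_cases hjk : k = j
    · exact hjk ▸ hk
    · exact absurd hyj (disjoint_left.1 (hdisj hjk) hyk)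
  refine ⟨contDiff_iff_contDiffAt.2 fun x => ?_, hχ.2.1.mono' (subset_closure.trans hsub), hVj⟩
  by_cases hx : x ∈ tsupport ((V j).indicator χ)
  swap
  · exact contDiffAt_const.congr_of_eventuallyEq (notMem_tsupport_iff_eventuallyEq.1 hx)
  refine hχ.1.contDiffAt.congr_of_eventuallyEq ?_
  filter_upwards [(hV j).mem_nhds (hVj hx)] with y hy
  exact indicator_of_mem hy χ

theorem setIntegral_eq_integral_of_tsupport_subset {n : ℕ}
    {V : Set (EuclideanSpace ℝ (Fin n))} {f : EuclideanSpace ℝ (Fin n) → ℝ}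
    (hf : tsupport f ⊆ V) (h : EuclideanSpace ℝ (Fin n) → ℝ) :
    ∫ x in V, h x * f x = ∫ x, h x * f x :=
  setIntegral_eq_integral_of_forall_compl_eq_zero fun x hx => by
    rw [image_eq_zero_of_notMem_tsupport fun h => hx (hf h), mul_zero]

/-- Weak partial derivatives on disjoint open sets combine to one on their union. -/
theorem integral_mul_partialDeriv_of_iUnion {n : ℕ} {ι : Type*} [Fintype ι] (i : Fin n)
    {V : ι → Set (EuclideanSpace ℝ (Fin n))} (hV : ∀ j, IsOpen (V j))
    (hdisj : Pairwise fun j k => Disjoint (V j) (V k)) {u g : EuclideanSpace ℝ (Fin n) → ℝ}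
    (hug : ∀ j, IsWeakPartialDerivOn (V j) i u g) {χ : EuclideanSpace ℝ (Fin n) → ℝ}
    (hχ : IsTestFunctionOn (⋃ j, V j) χ) (hu : Integrable fun x => u x * partialDeriv i χ x)
    (hg : Integrable fun x => g x * χ x) :
    ∫ x, u x * partialDeriv i χ x = -∫ x, g x * χ x := by
  rw [← setIntegral_eq_integral_of_tsupport_subset
      ((tsupport_partialDeriv_subset i χ).trans hχ.2.2),
    ← setIntegral_eq_integral_of_tsupport_subset hχ.2.2,
    integral_iUnion_fintype (fun j => (hV j).measurableSet) hdisj fun j => hu.integrableOn,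
    integral_iUnion_fintype (fun j => (hV j).measurableSet) hdisj fun j => hg.integrableOn,
    ← Finset.sum_neg_distrib]
  refine Finset.sum_congr rfl fun j _ => ?_
  have h := hug j _ (hχ.indicator_of_iUnion hV hdisj j)
  rw [setIntegral_congr_fun (g := fun x => u x * partialDeriv i χ x) (hV j).measurableSet,
    setIntegral_congr_fun (f := fun x => g x * (V j).indicator χ x) (g := fun x => g x * χ x)
      (hV j).measurableSet] at h
  · exact h
  · intro x hx
    simp only [indicator_of_mem hx]
  · intro x hx
    have : (V j).indicator χ =ᶠ[𝓝 x] χ := by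
      filter_upwards [(hV j).mem_nhds hx] with y hy
      exact indicator_of_mem hy χ
    simp only [partialDeriv, this.fderiv_eq]

/-! ### Crossing the exceptional set -/

/-- A square integrable weak partial derivative off a compact set of finite
`(n - 1)`-dimensional Hausdorff measure is one across this set, for continuous functions. -/
theorem isWeakPartialDerivOn_of_hausdorffMeasure_lt_top {n : ℕ} (hn : 1 ≤ n) (i : Fin n)
    {U F : Set (EuclideanSpace ℝ (Fin n))} (hU : IsOpen U) (hF : IsCompact F)
    (h : Measure.hausdorffMeasure ((n : ℝ) - 1) F < ⊤) {u g : EuclideanSpace ℝ (Fin n) → ℝ}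
    (hu : ContinuousOn u U) (hg : MemLp g 2)
    (hug : ∀ χ, IsTestFunctionOn (U \ F) χ → (Integrable fun x => u x * partialDeriv i χ x) →
      (Integrable fun x => g x * χ x) → ∫ x, u x * partialDeriv i χ x = -∫ x, g x * χ x) :
    IsWeakPartialDerivOn U i u g := by
  intro φ hφ
  obtain ⟨hφc, hφs, hφU⟩ := hφ
  rw [setIntegral_eq_integral_of_tsupport_subset ((tsupport_partialDeriv_subset i φ).trans hφU),
    setIntegral_eq_integral_of_tsupport_subset hφU]
  -- `u` is controlled only on `U`, but its product with a continuous function supported inside `U`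
  -- is continuous everywhere.
  have hcont : ∀ f : EuclideanSpace ℝ (Fin n) → ℝ, Continuous f → tsupport f ⊆ U →
      Continuous fun x => u x * f x := fun f hf hfU =>
    (hu.mul hf.continuousOn).continuous_of_tsupport_subset hU
      ((tsupport_mul_subset_right (f := u) (g := f)).trans hfU)
  have hintu : ∀ χ : EuclideanSpace ℝ (Fin n) → ℝ, ContDiff ℝ ∞ χ → HasCompactSupport χ →
      tsupport χ ⊆ U → Integrable fun x => u x * partialDeriv i χ x := fun χ hχ hχs hχU =>
    (hcont _ (continuous_partialDeriv i hχ)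
      ((tsupport_partialDeriv_subset i χ).trans hχU)).integrable_of_hasCompactSupport
      (hχs.mono' (subset_closure.trans (tsupport_partialDeriv_subset i _))).mul_left
  have hintg : ∀ χ : EuclideanSpace ℝ (Fin n) → ℝ, ContDiff ℝ ∞ χ → HasCompactSupport χ →
      Integrable fun x => g x * χ x := fun χ hχ hχs =>
    hg.integrable_mul (hχ.continuous.memLp_of_hasCompactSupport (p := 2) hχs)
  obtain ⟨C, hC⟩ := exists_cutoff_of_hausdorffMeasure_lt_top hn i hF h
  -- The widths `1 / (m + 1)` tend to 0 and are at most 1, so all supports lie in one compact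
  -- thickening of `F`.
  choose η hη hηs hη01 hηF hη0 hηC using fun m : ℕ => hC (1 / ((m : ℝ) + 1)) (by positivity)
  have hlim : ∀ᵐ x, Tendsto (fun m => η m x) atTop (𝓝 0) := by
    filter_upwards [measure_eq_zero_iff_ae_notMem.1 (volume_eq_zero_of_hausdorffMeasure_lt_top h)]
      with x hx
    obtain ⟨δ, hδ, hxδ⟩ : ∃ δ > 0, x ∉ thickening δ F := by
      rw [← hF.isClosed.closure_eq, closure_eq_iInter_thickening] at hx
      simpa using hx
    refine tendsto_const_nhds.congr' ?_
    filter_upwards [(tendsto_one_div_add_atTop_nhds_zero_nat (𝕜 := ℝ)).eventually_lt_const hδ]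
      with m hm
    exact (hη0 m x fun hx' => hxδ (thickening_mono hm.le F hx')).symm
  have hw : UniformContinuous fun x => u x * φ x :=
    hφs.mul_left.uniformContinuous_of_continuous (hcont φ hφc.continuous hφU)
  have hlim0 := tendsto_integral_mul_partialDeriv_zero i hη
    (fun m x => abs_le.2 ⟨by linarith [(hη01 m x).1], (hη01 m x).2⟩) (hF.cthickening (r := 1))
    (fun m x hx => hη0 m x fun hx' => hx (thickening_subset_cthickening _ _ (thickening_mono
      (by rw [div_le_one (by positivity)]; linarith [(m.cast_nonneg : (0 : ℝ) ≤ m)]) F hx')))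
    hlim hηC hw
  have hψ : ∀ {f : EuclideanSpace ℝ (Fin n) → ℝ}, Integrable f →
      Tendsto (fun m => ∫ x, f x * (1 - η m x)) atTop (𝓝 (∫ x, f x)) := by
    intro f hf
    simpa using tendsto_integral_mul_of_ae_tendsto hf (ψ := fun m x => 1 - η m x) (c := 1)
      (fun m => (continuous_const.sub (hη m).continuous).aestronglyMeasurable)
      (fun m x => abs_le.2 ⟨by linarith [(hη01 m x).2], by linarith [(hη01 m x).1]⟩)
      (hlim.mono fun x hx => by simpa using hx.const_sub 1)
  have hkey : ∀ m, (∫ x, u x * partialDeriv i φ x * (1 - η m x)) -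
      ∫ x, u x * φ x * partialDeriv i (η m) x = -∫ x, g x * φ x * (1 - η m x) := by
    intro m
    have hψm : ContDiff ℝ ∞ fun x => 1 - η m x := contDiff_const.sub (hη m)
    have hχ : ContDiff ℝ ∞ fun x => φ x * (1 - η m x) := hφc.mul hψm
    have hχs : HasCompactSupport fun x => φ x * (1 - η m x) := hφs.mul_right
    have hχφ : tsupport (fun x => φ x * (1 - η m x)) ⊆ tsupport φ := tsupport_mul_subset_left
    -- Avoiding `F` with the closed support uses that `η m` is 1 on a neighbourhood of `F`, not just
    -- on `F`.
    have hχF : tsupport (fun x => φ x * (1 - η m x)) ⊆ U \ F := by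
      refine fun x hx => ⟨hφU (hχφ hx), fun hxF => ?_⟩
      rw [← not_not (a := x ∈ tsupport _), notMem_tsupport_iff_eventuallyEq] at hx
      refine hx ?_
      filter_upwards [(hηF m).filter_mono (nhds_le_nhdsSet hxF)] with y hy
      simp [hy]
    have e := hug _ ⟨hχ, hχs, hχF⟩ (hintu _ hχ hχs (hχφ.trans hφU)) (hintg _ hχ hχs)
    have hi1 : Integrable fun x => u x * partialDeriv i φ x * (1 - η m x) :=
      ((hcont _ (continuous_partialDeriv i hφc)
        ((tsupport_partialDeriv_subset i φ).trans hφU)).mul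
          hψm.continuous).integrable_of_hasCompactSupport
        ((hφs.mono' (subset_closure.trans (tsupport_partialDeriv_subset i _))).mul_left.mul_right)
    have hi2 : Integrable fun x => u x * φ x * partialDeriv i (η m) x :=
      (hw.continuous.mul (continuous_partialDeriv i (hη m))).integrable_of_hasCompactSupport
        hφs.mul_left.mul_right
    rw [← integral_sub hi1 hi2]
    simp_rw [mul_assoc (g _)]
    rw [← e]
    congr 1 with x
    rw [partialDeriv_mul i (hφc.differentiable (by simp)) (hψm.differentiable (by simp)),
      partialDeriv_one_sub]
    ring
  have hL := (hψ (hintu φ hφc hφs hφU)).sub hlim0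
  rw [sub_zero] at hL
  exact tendsto_nhds_unique (hL.congr hkey) (hψ (hintg φ hφc hφs)).neg

/-! ### The piecewise Sobolev function -/

theorem theorem1 (n : ℕ) (hn : 1 ≤ n) (K : ℕ)
    (U : Set (EuclideanSpace ℝ (Fin n))) (Us : Fin K → Set (EuclideanSpace ℝ (Fin n)))
    (hU_open : IsOpen U) (hU_bdd : Bornology.IsBounded U)
    (hUs_open : ∀ j, IsOpen (Us j)) (hUs_bdd : ∀ j, Bornology.IsBounded (Us j))
    (hUs_disj : Pairwise fun j k => Disjoint (Us j) (Us k))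
    (hclosure : closure U = ⋃ j, closure (Us j))
    (hfrontier : ∀ j, Measure.hausdorffMeasure ((n : ℝ) - 1) (frontier (Us j)) < ⊤)
    (u : EuclideanSpace ℝ (Fin n) → ℝ)
    (hu_cont : ContinuousOn u (closure U))
    (hu_H1 : ∀ j, MemH1 (Us j) u) :
    MemH1 U u := by
  have hu : ContinuousOn u U := hu_cont.mono subset_closure
  refine ⟨?_, fun i => ?_⟩
  · obtain ⟨M, hM⟩ := hU_bdd.isCompact_closure.exists_bound_of_continuousOn hu_cont
    have : IsFiniteMeasure (volume.restrict U) := ⟨by simpa using hU_bdd.measure_lt_top⟩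
    exact MemLp.of_bound (hu.aestronglyMeasurable hU_open.measurableSet) M
      (ae_restrict_of_forall_mem hU_open.measurableSet fun x hx => hM x (subset_closure hx))
  choose g hg2 hg using fun j => (hu_H1 j).2 i
  -- Extension by zero puts `G` in `L²` of the whole space; by disjointness it equals `g j` on `Us
  -- j`.
  set G : EuclideanSpace ℝ (Fin n) → ℝ := fun x => ∑ j, (Us j).indicator (g j) x with hG
  have hG2 : MemLp G 2 := memLp_finsetSum _ fun j _ =>
    (memLp_indicator_iff_restrict (hUs_open j).measurableSet).2 (hg2 j)
  have hGj : ∀ j, ∀ x ∈ Us j, G x = g j x := by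
    intro j x hx
    rw [hG]
    dsimp only
    rw [Finset.sum_eq_single j (fun k _ hkj => indicator_of_notMem
      (disjoint_right.1 (hUs_disj hkj) hx) _) (by simp), indicator_of_mem hx]
  refine ⟨G, hG2.restrict U, isWeakPartialDerivOn_of_hausdorffMeasure_lt_top hn i hU_open
    (F := ⋃ j, frontier (Us j))
    (isCompact_iUnion fun j => (hUs_bdd j).isCompact_closure.of_isClosed_subset isClosed_frontier
      frontier_subset_closure)
    ((measure_iUnion_fintype_le _ _).trans_lt (ENNReal.sum_lt_top.2 fun j _ => hfrontier j))
    hu hG2 fun χ hχ hχu hχG => integral_mul_partialDeriv_of_iUnion i hUs_open hUs_disj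
      (fun j φ hφ => ?_) ⟨hχ.1, hχ.2.1, fun x hx => ?_⟩ hχu hχG⟩
  · rw [hg j φ hφ, setIntegral_congr_fun (hUs_open j).measurableSet fun x hx => ?_]
    simp only [hGj j x hx]
  -- A point of `U` lies in the closure of some piece; being off its frontier, it is in the
  -- interior, hence in the piece.
  · obtain ⟨hxU, hxF⟩ := hχ.2.2 hx
    obtain ⟨j, hj⟩ := mem_iUnion.1 (hclosure ▸ subset_closure hxU : x ∈ ⋃ j, closure (Us j))
    by_contra hxV
    exact hxF (mem_iUnion.2 ⟨j, hj, fun hxj => hxV (mem_iUnion.2 ⟨j, interior_subset hxj⟩)⟩)
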